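/- Notation. Let $\mathrm{Sym}_0(3)$ be the space of traceless symmetric real $3\times 3$ matrices with inner product $A\cdot B=\sum_{i,j}A_{ij}B_{ij}$, let $\mathcal{Q}=\{Q\in\mathrm{Sym}_0(3): \text{every eigenvalue of } Q \text{ is } >-\tfrac13\}$, and let $dp$ be surface area on $\mathbb{S}^2\subset\mathbb{R}^3$. Let $\mathcal{P}(\mathbb{S}^2)$ be the set of $f\in L^1(\mathbb{S}^2)$ with $f\ge 0$ a.e. and $\int_{\mathbb{S}^2} f\,dp=1$. For $f\in\mathcal{P}(\mathbb{S}^2)$ and $\eta\in\mathbb{R}$ put $$\mathcal{F}(f,\eta)=\int_{\mathbb{S}^2} f(p)\ln f(p)-f(p)\ln\Big(\int_{\mathbb{S}^2}\big((p\cdot q)^2-\tfrac13\big)f(q)\,dq-\eta\Big)\,dp\in\mathbb{R}\cup\{+\infty\},$$ where $-\ln x=+\infty$ for $x\le 0$ and $0\cdot(+\infty)=0$. For $Q\in\mathrm{Sym}_0(3)$ let $$A(Q)=\Big\{f\in\mathcal{P}(\mathbb{S}^2):\int_{\mathbb{S}^2}\big(p\otimes p-\tfrac13 I\big)f(p)\,dp=Q\Big\},\qquad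 J(Q,\eta)=\inf_{f\in A(Q)}\mathcal{F}(f,\eta),$$ with $\inf\emptyset=+\infty$, let $\mathrm{dom}(J)=\{(Q,\eta)\in\mathcal{Q}\times\mathbb{R}:J(Q,\eta)<+\infty\}$, and let $E_Q=\{p\in\mathbb{S}^2:Qp\cdot p>\eta\}$. For $(Q,\eta)\in\mathrm{dom}(J)$ let $f_Q$ denote the minimiser of $\mathcal{F}(\cdot,\eta)$ on $A(Q)$ (the optimal energy distribution), and let $\Lambda(Q,\eta)$ denote the maximiser over $\lambda\in\mathrm{Sym}_0(3)$ of the dual objective function $$F(Q,\lambda)=\lambda\cdot Q-\ln\int_{\mathbb{S}^2}\exp(\lambda p\cdot p)\max(Qp\cdot p-\eta,0)\,dp.$$ Proposition. The set $\mathrm{dom}(J)$ is open in $\mathrm{Sym}_0(3)\times\mathbb{R}$; for every $(Q,\eta)\in\mathrm{dom}(J)$ the maximiser $\Lambda(Q,\eta)$ exists and is unique, and the minimiser $f_Q$ exists and is unique up to null sets. The function $J$ is real-valued and jointly $C^1$ in $(Q,\eta)$ on $\mathrm{dom}(J)$. At every $(Q,\eta)\in\mathrm{dom}(J)$ the function $p\mapsto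 f_Q(p)/(Qp\cdot p-\eta)$ is integrable over $E_Q$, and $$\frac{\partial J}{\partial Q}=\Lambda(Q,\eta)-\int_{E_Q}\frac{f_Q(p)}{Qp\cdot p-\eta}\Big(p\otimes p-\frac13 I\Big)\,dp,\qquad \frac{\partial J}{\partial\eta}=+\int_{E_Q}\frac{f_Q(p)}{Qp\cdot p-\eta}\,dp,$$ where $\partial J/\partial Q$ is the gradient in $\mathrm{Sym}_0(3)$ with respect to the inner product above. -/

import Mathlib

open MeasureTheory Set

noncomputable section

namespace Nematic

/-- The unit sphere `𝕊²` of `ℝ³`. -/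
abbrev S2 : Type := Metric.sphere (0 : EuclideanSpace ℝ (Fin 3)) 1

/-- Surface area on `𝕊²` (total mass `4π`): the two-dimensional Hausdorff measure in its usual
normalisation. -/
def area : Measure S2 := (volume : Measure (EuclideanSpace ℝ (Fin 3))).toSphere

/-- `Sym₀(3)`: the traceless symmetric real `3 × 3` matrices. A matrix is stored as the family of
its nine entries, with the Euclidean inner product `A · B = ∑ A i j * B i j` (Frobenius). -/
def symTraceless : Submodule ℝ (EuclideanSpace ℝ (Fin 3 × Fin 3)) where
  carrier := {A | (∀ i j, A (i, j) = A (j, i)) ∧ ∑ i, A (i, i) = 0}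
  add_mem' := fun hA hB =>
    ⟨fun i j => by simp [hA.1 i j, hB.1 i j], by simp [Finset.sum_add_distrib, hA.2, hB.2]⟩
  zero_mem' := ⟨fun _ _ => by simp, by simp⟩
  smul_mem' := fun c _ hA =>
    ⟨fun i j => by simp [hA.1 i j], by simp [← Finset.mul_sum, hA.2]⟩

/-- `Sym₀(3)` as a type. -/
abbrev Sym0 : Type := symTraceless

/-- The element of `Sym₀(3)` as a matrix. -/
def mat (A : Sym0) : Matrix (Fin 3) (Fin 3) ℝ := Matrix.of fun i j => A.1 (i, j)

/-- The quadratic form `A p · p`. -/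
def quad (A : Sym0) (p : S2) : ℝ := ∑ i, ∑ j, mat A i j * p.1 i * p.1 j

/-- `p ⊗ p - I / 3`, as an element of `Sym₀(3)`. -/
def pointTensor (p : S2) : Sym0 :=
  ⟨WithLp.toLp 2 fun ij => p.1 ij.1 * p.1 ij.2 - (1 / 3) * (if ij.1 = ij.2 then 1 else 0), by
    refine ⟨fun i j => ?_, ?_⟩
    · simp [mul_comm, eq_comm]
    · have h : ‖p.1‖ = 1 := by simp
      have h2 : ∑ i, p.1 i ^ 2 = 1 := by
        rw [← EuclideanSpace.real_norm_sq_eq, h, one_pow]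
      simp [Finset.sum_sub_distrib, ← sq, h2]⟩

/-- The physical Q-tensors: every eigenvalue is larger than `-1/3`. -/
def physical : Set Sym0 := {Q | ∀ v ∈ spectrum ℝ (mat Q), -(1 / 3 : ℝ) < v}

/-- The probability densities `𝒫(𝕊²)`. -/
def densities : Set (S2 → ℝ) :=
  {f | Integrable f area ∧ (∀ᵐ p ∂area, 0 ≤ f p) ∧ ∫ p, f p ∂area = 1}

/-- The integral of an extended-real function, as the integral of its positive part minus that of
its negative part. -/
def extIntegral (g : S2 → EReal) : EReal :=
  ((∫⁻ p, (g p).toENNReal ∂area : ENNReal) : EReal)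
    - ((∫⁻ p, (-g p).toENNReal ∂area : ENNReal) : EReal)

/-- `-ln x`, extended by `+∞` for `x ≤ 0`. -/
def negLog (x : ℝ) : EReal := if 0 < x then ((-Real.log x : ℝ) : EReal) else ⊤

/-- The free energy `∫ f ln f - f ln (∫ ((p · q)² - 1/3) f(q) dq - η) dp`; in `EReal` one has
`0 * ⊤ = 0`. -/
def energy (f : S2 → ℝ) (η : ℝ) : EReal :=
  extIntegral fun p =>
    ((f p * Real.log (f p) : ℝ) : EReal)
      + (f p : EReal)
        * negLog ((∫ q, ((inner ℝ p.1 q.1) ^ 2 - 1 / 3) * f q ∂area) - η)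

/-- `A(Q)`: the densities whose Q-tensor is `Q`. -/
def admissible (Q : Sym0) : Set (S2 → ℝ) :=
  {f | f ∈ densities ∧ ∫ p, f p • pointTensor p ∂area = Q}

/-- `J(Q, η)`, the infimum of the energy over `A(Q)`. -/
def auxJ (Q : Sym0) (η : ℝ) : EReal := ⨅ f ∈ admissible Q, energy f η

/-- The domain of `J`: the pairs in `𝒬 × ℝ` at which `J` is finite. -/
def domJ : Set (Sym0 × ℝ) := {x | x.1 ∈ physical ∧ auxJ x.1 x.2 < ⊤}

/-- `E_Q = {p : Q p · p > η}`. -/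
def posSet (Q : Sym0) (η : ℝ) : Set S2 := {p | η < quad Q p}

/-- The dual objective function. -/
def dualF (Q : Sym0) (η : ℝ) (l : Sym0) : ℝ :=
  inner ℝ l Q - Real.log (∫ p, Real.exp (quad l p) * max (quad Q p - η) 0 ∂area)

/-- `L = Λ(Q, η)`: `L` maximises the dual objective function over `Sym₀(3)`. -/
def IsDualMaximiser (Q : Sym0) (η : ℝ) (L : Sym0) : Prop := ∀ l : Sym0, dualF Q η l ≤ dualF Q η L

/-- `f = f_Q`: `f` is an optimal energy distribution for `Q`, a minimiser of the energy on
`A(Q)`. -/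
def IsOptimal (Q : Sym0) (η : ℝ) (f : S2 → ℝ) : Prop :=
  f ∈ admissible Q ∧ ∀ g ∈ admissible Q, energy f η ≤ energy g η

end Nematic

end

/-!
For `f ∈ A(Q)` the mean-field argument of the logarithm is `Q p · p - η`, because
`(p · q)² - 1/3` is the inner product of `p ⊗ p - I/3` and `q ⊗ q - I/3`. On `A(Q)` the energy is
therefore the relative entropy of `f` with respect to the weight `w = max (Q p · p - η) 0`, and
`J(Q, η)` is the value of a convex minimisation problem with linear constraints.

*Duality.* For a multiplier `l` let `Z = ∫ exp (l p · p) w` and let `g = exp (l p · p) w / Z` be its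
Gibbs density. Young's inequality `u c + u - exp c * w ≤ u log u - u log w`, whose gap is a
Kullback-Leibler density, integrates to `F(Q, l) ≤ 𝓕(f, η)` with equality only for `f = g`
(`dualF_le_energy`, `ae_eq_gibbs_of_energy_le`). If `l` maximises `F(Q, ·)`, the first-order
condition says `g ∈ A(Q)` (`gibbs_mem_admissible`), so `g` is the unique minimiser and `J = F(Q, l)`
(`auxJ_eq_dualF`).

*The domain.* A nonzero traceless quadratic form has null level sets on the sphere (`ae_quad_ne`).
A density of finite energy is carried by `E_Q`, and so its tensor `Q` lies strictly inside every
half space of tensors containing the tensors of `E_Q`: for each `l ≠ 0` some `p ∈ E_Q` has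
`l p · p > l · Q` (`domJ_subset_nondegenerate`). This condition is open, by compactness of the unit
sphere of multipliers, and it makes `F(Q, ·)` coercive, locally uniformly in `(Q, η)`
(`exists_dualF_le`); hence a maximiser exists, and the condition characterises `dom J`
(`domJ_eq_nondegenerate`). Equality of the Gibbs densities of two maximisers makes the difference of
the quadratic forms constant on `E_Q`, so the maximiser is unique (`IsDualMaximiser.unique`).
Uniqueness and uniform coercivity make it continuous in `(Q, η)` (`continuousAt_multiplier`).

*Regularity.* For fixed `l` the function `F` is differentiable in `(Q, η)`, as the set
`Q p · p = η`, where the positive part has a kink, is null, and the derivative is jointly continuous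
in `(Q, η, l)`. The envelope theorem (`hasFDerivAt_of_forall_le`) then gives
`DJ(Q, η) = D F(Q, η, Λ(Q, η))`, which is continuous. On `E_Q` the quotient `f_Q / (Q p · p - η)`
equals `exp (Λ p · p) / Z`, and this identifies the derivative with the two integrals.
-/

namespace Nematic

open Filter Topology

/-! ### Quadratic forms on the sphere -/

instance : IsFiniteMeasure area := by
  unfold area; infer_instance

instance : area.IsOpenPosMeasure := by
  unfold area; infer_instance

theorem quad_eq_inner (A : Sym0) (p : S2) : quad A p = inner ℝ A (pointTensor p) := by
  have ht : ∑ i, A.1 (i, i) = 0 := A.2.2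
  have : inner ℝ A (pointTensor p) = ∑ x : Fin 3 × Fin 3,
      (A.1 x * (p.1 x.1 * p.1 x.2) - (1 / 3) * (if x.1 = x.2 then A.1 x else 0)) := by
    rw [Submodule.coe_inner, PiLp.inner_apply]
    refine Finset.sum_congr rfl fun x _ => ?_
    simp only [pointTensor, RCLike.inner_apply, conj_trivial]
    split_ifs <;> ring
  rw [this, Fintype.sum_prod_type]
  simp only [Finset.sum_sub_distrib, ← Finset.mul_sum, Finset.sum_ite_eq, Finset.mem_univ,
    if_true, ht, mul_zero, sub_zero]
  simp only [quad, mat, Matrix.of_apply, mul_assoc]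

/-- `real_inner_smul_left` for the scalar multiplication that `Sym0` has as a submodule, which is
not syntactically the one of its inner product space structure; this form is used for
rewriting. -/
theorem inner_smul_sym0 (r : ℝ) (A B : Sym0) : inner ℝ (r • A) B = r * inner ℝ A B :=
  real_inner_smul_left A B r

theorem quad_pointTensor (p q : S2) :
    quad (pointTensor p) q = (inner ℝ p.1 q.1) ^ 2 - 1 / 3 := by
  have h : ‖q.1‖ = 1 := by simp
  have h2 : ∑ i, q.1 i ^ 2 = 1 := by
    rw [← EuclideanSpace.real_norm_sq_eq, h, one_pow]
  simp only [quad, mat, Matrix.of_apply, pointTensor, PiLp.inner_apply, RCLike.inner_apply,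
    conj_trivial]
  simp only [Fin.sum_univ_three] at h2 ⊢
  simp
  linear_combination (-1 / 3) * h2

theorem norm_pointTensor_le (p : S2) : ‖pointTensor p‖ ≤ 1 := by
  have h : ‖pointTensor p‖ ^ 2 = 1 - 1 / 3 := by
    rw [← real_inner_self_eq_norm_sq, ← quad_eq_inner, quad_pointTensor,
      real_inner_self_eq_norm_sq]
    simp
  nlinarith [norm_nonneg (pointTensor p)]

@[fun_prop]
theorem continuous_pointTensor : Continuous pointTensor := by
  refine Continuous.subtype_mk ?_ _
  fun_prop

theorem abs_quad_le (A : Sym0) (p : S2) : |quad A p| ≤ ‖A‖ := by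
  rw [quad_eq_inner]
  exact (abs_real_inner_le_norm _ _).trans
    (mul_le_of_le_one_right (norm_nonneg _) (norm_pointTensor_le p))

@[fun_prop]
theorem continuous_quad (A : Sym0) : Continuous (quad A) := by
  have h : quad A = fun p => inner ℝ A (pointTensor p) := funext fun p => quad_eq_inner A p
  rw [h]
  fun_prop

/-- A nonzero traceless quadratic form has null level sets on the sphere: the cone
`{x | A x · x = c |x|²}` is the zero set of a nonzero quadratic form, which meets every line
in some fixed direction in at most two points. -/
theorem ae_quad_ne {A : Sym0} (hA : A ≠ 0) (c : ℝ) : ∀ᵐ p ∂area, quad A p ≠ c := by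
  set P : EuclideanSpace ℝ (Fin 3) → ℝ :=
    fun x => ∑ i, ∑ j, A.1 (i, j) * x i * x j - c * ∑ i, x i ^ 2 with hP
  have hsymm := A.2.1
  have htr := A.2.2
  obtain ⟨v, hv⟩ : ∃ v, P v ≠ 0 := by
    by_contra! h
    -- Vectors with entries `0` and `1` show that the matrix is `c` times the identity, and `c = 0`
    -- because the trace vanishes.
    have h0 : ∀ a b d : ℝ, P !₂[a, b, d] = 0 := fun a b d => h _
    simp only [hP, Fin.sum_univ_three] at h0 htr
    simp at h0
    have s01 := hsymm 0 1
    have s02 := hsymm 0 2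
    have s12 := hsymm 1 2
    have e1 := h0 1 0 0
    have e2 := h0 0 1 0
    have e3 := h0 0 0 1
    have e4 := h0 1 1 0
    have e5 := h0 1 0 1
    have e6 := h0 0 1 1
    simp at e1 e2 e3 e4 e5 e6
    apply hA
    ext ⟨i, j⟩
    fin_cases i <;> fin_cases j <;> simp <;> linarith
  have hPc : Continuous P := by
    simp only [hP]; fun_prop
  have hae : ∀ᵐ x ∂(volume : Measure (EuclideanSpace ℝ (Fin 3))), x ∈ {x | P x ≠ 0} := by
    refine ae_mem_of_ae_add_linearMap_mem (LinearMap.toSpanSingleton ℝ _ v) volume volume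
      (hPc.measurable (measurableSet_singleton 0).compl) fun y => ?_
    obtain ⟨b, hb⟩ : ∃ b, b =
      ∑ i, ∑ j, A.1 (i, j) * (y i * v j + v i * y j) - 2 * c * ∑ i, y i * v i := ⟨_, rfl⟩
    -- `R` is the restriction of `P` to the line `t ↦ y + t v`.
    set R : Polynomial ℝ := Polynomial.C (P v) * Polynomial.X ^ 2
      + Polynomial.C b * Polynomial.X + Polynomial.C (P y) with hR
    have hR0 : R ≠ 0 := by
      intro h
      apply hv
      have := congrArg (fun q => Polynomial.coeff q 2) h
      simpa [hR, Polynomial.coeff_X, Polynomial.coeff_C] using this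
    have hfin : {t : ℝ | R.eval t = 0}.Finite := by
      refine (R.roots.toFinset.finite_toSet).subset fun t ht => ?_
      simpa [hR0] using ht
    filter_upwards [hfin.countable.ae_notMem volume] with t ht
    intro h
    apply ht
    rw [← h]
    simp only [hR, hP, hb, Fin.sum_univ_three]
    simp
    ring
  have hm : MeasurableSet {p : S2 | quad A p = c} :=
    (continuous_quad A).measurable (measurableSet_singleton c)
  rw [ae_iff] at hae ⊢
  simp only [ne_eq, not_not] at hae ⊢
  rw [area, Measure.toSphere_apply' _ hm]
  refine mul_eq_zero_of_right _ (measure_mono_null ?_ hae)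
  rintro _ ⟨r, hr, _, ⟨p, hp, rfl⟩, rfl⟩
  have h : ‖p.1‖ = 1 := by simp
  have h2 : ∑ i, p.1 i ^ 2 = 1 := by
    rw [← EuclideanSpace.real_norm_sq_eq, h, one_pow]
  simp only [mem_ofPred_eq, quad, mat, Matrix.of_apply, hP, Fin.sum_univ_three] at hp h2 ⊢
  simp
  linear_combination r ^ 2 * hp - r ^ 2 * c * h2

/-! ### Integrals of extended-real functions -/

theorem extIntegral_coe {h : S2 → ℝ} (hh : Integrable h area) :
    extIntegral (fun p => (h p : EReal)) = ((∫ p, h p ∂area : ℝ) : EReal) := by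
  have h1 : ∫⁻ p, ENNReal.ofReal (h p) ∂area ≠ ⊤ := hh.lintegral_lt_top.ne
  have h2 : ∫⁻ p, ENNReal.ofReal (-h p) ∂area ≠ ⊤ := hh.neg.lintegral_lt_top.ne
  simp only [extIntegral, ← EReal.coe_neg, EReal.real_coe_toENNReal]
  rw [integral_eq_lintegral_pos_part_sub_lintegral_neg_part hh, EReal.coe_sub,
    EReal.coe_ennreal_toReal h1, EReal.coe_ennreal_toReal h2]

theorem extIntegral_congr {e e' : S2 → EReal} (h : e =ᵐ[area] e') :
    extIntegral e = extIntegral e' := by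
  have h1 : ∫⁻ p, (e p).toENNReal ∂area = ∫⁻ p, (e' p).toENNReal ∂area :=
    lintegral_congr_ae (h.mono fun p hp => by simp only [hp])
  have h2 : ∫⁻ p, (-e p).toENNReal ∂area = ∫⁻ p, (-e' p).toENNReal ∂area :=
    lintegral_congr_ae (h.mono fun p hp => by simp only [hp])
  rw [extIntegral, extIntegral, h1, h2]

theorem integral_le_extIntegral {h : S2 → ℝ} (hh : Integrable h area) {e : S2 → EReal}
    (he : ∀ᵐ p ∂area, (h p : EReal) ≤ e p) :
    ((∫ p, h p ∂area : ℝ) : EReal) ≤ extIntegral e := by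
  rw [← extIntegral_coe hh]
  refine EReal.sub_le_sub (EReal.coe_ennreal_le_coe_ennreal_iff.2 (lintegral_mono_ae ?_))
    (EReal.coe_ennreal_le_coe_ennreal_iff.2 (lintegral_mono_ae ?_))
  · exact he.mono fun p hp => EReal.toENNReal_le_toENNReal hp
  · exact he.mono fun p hp => EReal.toENNReal_le_toENNReal (EReal.neg_le_neg_iff.2 hp)

/-- A function with an integrable minorant and an integral below `⊤` has integrable positive and
negative parts; the minorant excludes the convention `⊤ - ⊤ = ⊥` in the extended integral. -/
theorem lintegral_toENNReal_ne_top {h : S2 → ℝ} (hh : Integrable h area) {e : S2 → EReal}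
    (he : ∀ᵐ p ∂area, (h p : EReal) ≤ e p) (hlt : extIntegral e < ⊤) :
    ∫⁻ p, (e p).toENNReal ∂area ≠ ⊤ ∧ ∫⁻ p, (-e p).toENNReal ∂area ≠ ⊤ := by
  have hneg : ∫⁻ p, (-e p).toENNReal ∂area ≠ ⊤ := by
    refine ((lintegral_mono_ae (he.mono fun p hp => ?_)).trans_lt hh.neg.lintegral_lt_top).ne
    rw [Pi.neg_apply, ← EReal.real_coe_toENNReal, EReal.coe_neg]
    exact EReal.toENNReal_le_toENNReal (EReal.neg_le_neg_iff.2 hp)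
  refine ⟨fun htop => hlt.ne ?_, hneg⟩
  rw [extIntegral, htop, ← ENNReal.coe_toNNReal hneg]
  rfl

theorem ae_ne_top_of_extIntegral_lt_top {h : S2 → ℝ} (hh : Integrable h area) {e : S2 → EReal}
    (hm : AEMeasurable e area) (he : ∀ᵐ p ∂area, (h p : EReal) ≤ e p)
    (hlt : extIntegral e < ⊤) : ∀ᵐ p ∂area, e p ≠ ⊤ := by
  filter_upwards [ae_lt_top' hm.ereal_toENNReal (lintegral_toENNReal_ne_top hh he hlt).1] with p hp
  exact EReal.toENNReal_ne_top_iff.1 hp.ne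

theorem ae_eq_of_extIntegral_le {h : S2 → ℝ} (hh : Integrable h area) {e : S2 → EReal}
    (hm : AEMeasurable e area) (he : ∀ᵐ p ∂area, (h p : EReal) ≤ e p)
    (hle : extIntegral e ≤ ((∫ p, h p ∂area : ℝ) : EReal)) :
    ∀ᵐ p ∂area, e p = h p := by
  have htop := ae_ne_top_of_extIntegral_lt_top hh hm he (hle.trans_lt (EReal.coe_lt_top _))
  -- Both functions are real-valued almost everywhere, so `e - h` is a nonnegative function of
  -- nonpositive integral.
  have hcoe : ∀ᵐ p ∂area, e p = ((e p).toReal : EReal) := by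
    filter_upwards [htop, he] with p h1 h2
    exact (EReal.coe_toReal h1 ((EReal.bot_lt_coe _).trans_le h2).ne').symm
  have hle' : ∀ᵐ p ∂area, h p ≤ (e p).toReal := by
    filter_upwards [hcoe, he] with p h1 h2
    rwa [h1, EReal.coe_le_coe_iff] at h2
  obtain ⟨hpos, hneg⟩ := lintegral_toENNReal_ne_top hh he (hle.trans_lt (EReal.coe_lt_top _))
  have hint : Integrable (fun p => (e p).toReal) area := by
    refine ⟨hm.ereal_toReal.aestronglyMeasurable, ?_⟩
    rw [hasFiniteIntegral_iff_norm]
    have : ∀ᵐ p ∂area, ENNReal.ofReal ‖(e p).toReal‖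
        ≤ (e p).toENNReal + (-e p).toENNReal := by
      filter_upwards [hcoe] with p hp
      rw [hp, ← EReal.coe_neg, EReal.real_coe_toENNReal, EReal.real_coe_toENNReal,
        EReal.toReal_coe]
      rcases le_total 0 (e p).toReal with h0 | h0
      · rw [Real.norm_of_nonneg h0]; exact le_self_add
      · rw [Real.norm_of_nonpos h0]; exact le_add_self
    refine (lintegral_mono_ae this).trans_lt ?_
    rw [lintegral_add_left' hm.ereal_toENNReal]
    exact ENNReal.add_lt_top.2 ⟨hpos.lt_top, hneg.lt_top⟩
  rw [extIntegral_congr hcoe, extIntegral_coe hint, EReal.coe_le_coe_iff] at hle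
  have h0 : ∀ᵐ p ∂area, (e p).toReal - h p = 0 := by
    refine (integral_eq_zero_iff_of_nonneg_ae (hle'.mono fun p hp => sub_nonneg.2 hp)
      (hint.sub hh)).1 (le_antisymm ?_
        (integral_nonneg_of_ae (hle'.mono fun p hp => sub_nonneg.2 hp)))
    rw [integral_sub hint hh]
    linarith
  filter_upwards [h0, hcoe] with p h1 h2
  rw [h2, sub_eq_zero.1 h1]

/-! ### The energy density -/

/-- The integrand of the energy: `u` stands for the value of the density and `w` for the argument
of the logarithm. -/
noncomputable def energyDensity (u w : ℝ) : EReal :=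
  ((u * Real.log u : ℝ) : EReal) + (u : EReal) * negLog w

theorem energyDensity_of_pos (u : ℝ) {w : ℝ} (hw : 0 < w) :
    energyDensity u w = ((u * Real.log u - u * Real.log w : ℝ) : EReal) := by
  rw [energyDensity, negLog, if_pos hw, ← EReal.coe_mul, ← EReal.coe_add]
  ring_nf

theorem energyDensity_zero (w : ℝ) : energyDensity 0 w = 0 := by
  simp [energyDensity]

theorem energyDensity_eq_top {u w : ℝ} (hu : 0 < u) (hw : w ≤ 0) : energyDensity u w = ⊤ := by
  rw [energyDensity, negLog, if_neg hw.not_gt, EReal.coe_mul_top_of_pos hu, EReal.coe_add_top]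

theorem aemeasurable_energyDensity {u w : S2 → ℝ} (hu : AEMeasurable u area)
    (hu0 : ∀ᵐ p ∂area, 0 ≤ u p) (hw : Measurable w) :
    AEMeasurable (fun p => energyDensity (u p) (w p)) area := by
  set φ : ℝ × ℝ → EReal := fun z => if 0 < z.2 then
    ((z.1 * Real.log z.1 - z.1 * Real.log z.2 : ℝ) : EReal) else if z.1 = 0 then 0 else ⊤
  have hφ : Measurable φ := by
    refine Measurable.ite (measurableSet_lt measurable_const measurable_snd) ?_
      (Measurable.ite (measurable_fst (measurableSet_singleton 0)) measurable_const
        measurable_const)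
    exact Measurable.coe_real_ereal (by fun_prop)
  refine (hφ.comp_aemeasurable (hu.prodMk hw.aemeasurable)).congr ?_
  filter_upwards [hu0] with p hp
  simp only [φ, Function.comp_apply]
  split_ifs with h1 h2
  · rw [energyDensity_of_pos _ h1]
  · rw [h2, energyDensity_zero]
  · rw [energyDensity_eq_top (lt_of_le_of_ne hp (Ne.symm h2)) (not_lt.1 h1)]

/-- The identity behind the Gibbs inequality: for positive `w` the gap in the Young inequality
`u c + u - exp c * w ≤ u log u - u log w` is a Kullback-Leibler density. -/
theorem energyDensity_sub_eq_klFun (u c : ℝ) {w : ℝ} (hw : 0 < w) :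
    u * Real.log u - u * Real.log w - (u * c + u - Real.exp c * w)
      = Real.exp c * w * InformationTheory.klFun (u / (Real.exp c * w)) := by
  have he := Real.exp_pos c
  rw [InformationTheory.klFun_apply]
  rcases eq_or_ne u 0 with rfl | hu
  · simp
  · rw [Real.log_div hu (by positivity), Real.log_mul he.ne' hw.ne', Real.log_exp]
    field_simp
    ring

theorem le_energyDensity {u : ℝ} (hu : 0 ≤ u) (c w : ℝ) :
    ((u * c + u - Real.exp c * max w 0 : ℝ) : EReal) ≤ energyDensity u w := by
  rcases lt_or_ge 0 w with hw | hw
  · rw [energyDensity_of_pos _ hw, max_eq_left hw.le, EReal.coe_le_coe_iff, ← sub_nonneg,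
      energyDensity_sub_eq_klFun u c hw]
    have := Real.exp_pos c
    have := InformationTheory.klFun_nonneg (x := u / (Real.exp c * w)) (by positivity)
    positivity
  · rcases hu.eq_or_lt with rfl | hu
    · simp [energyDensity_zero, max_eq_right hw]
    · rw [energyDensity_eq_top hu hw]; exact le_top

theorem eq_of_energyDensity_eq {u : ℝ} (hu : 0 ≤ u) {c w : ℝ}
    (h : energyDensity u w = ((u * c + u - Real.exp c * max w 0 : ℝ) : EReal)) :
    u = Real.exp c * max w 0 := by
  rcases lt_or_ge 0 w with hw | hw
  · have he := Real.exp_pos c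
    rw [energyDensity_of_pos _ hw, max_eq_left hw.le, EReal.coe_eq_coe_iff, ← sub_eq_zero,
      energyDensity_sub_eq_klFun u c hw, mul_eq_zero, or_iff_right (by positivity),
      InformationTheory.klFun_eq_zero_iff (by positivity)] at h
    rw [max_eq_left hw.le]
    field_simp at h
    exact h
  · rcases hu.eq_or_lt with rfl | hu
    · simp [max_eq_right hw]
    · rw [energyDensity_eq_top hu hw] at h
      exact absurd h (EReal.coe_ne_top _).symm

theorem energyDensity_gibbs (c w : ℝ) :
    energyDensity (Real.exp c * max w 0) w = ((Real.exp c * max w 0 * c : ℝ) : EReal) := by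
  rcases lt_or_ge 0 w with hw | hw
  · rw [max_eq_left hw.le, energyDensity_of_pos _ hw,
      Real.log_mul (Real.exp_pos c).ne' hw.ne', Real.log_exp]
    ring_nf
  · simp [max_eq_right hw, energyDensity_zero]

/-! ### Weak duality -/

/-- The partition function of the dual problem: `dualF Q η l = l · Q - log (partitionFn Q η l)`. -/
noncomputable def partitionFn (Q : Sym0) (η : ℝ) (l : Sym0) : ℝ :=
  ∫ p, Real.exp (quad l p) * max (quad Q p - η) 0 ∂area

/-- The Gibbs density `exp (l p · p) max (Q p · p - η) 0 / partitionFn Q η l`; at the maximiser `l`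
of the dual objective function it is the optimal energy distribution. -/
noncomputable def gibbs (Q : Sym0) (η : ℝ) (l : Sym0) (p : S2) : ℝ :=
  Real.exp (quad l p - Real.log (partitionFn Q η l)) * max (quad Q p - η) 0

theorem integrable_of_continuous {S E : Type*} [TopologicalSpace S] [CompactSpace S]
    [MeasurableSpace S] [OpensMeasurableSpace S] {μ : Measure S} [IsFiniteMeasure μ]
    [NormedAddCommGroup E] {f : S → E} (hf : Continuous f) : Integrable f μ :=
  hf.integrable_of_hasCompactSupport (HasCompactSupport.of_compactSpace f)

theorem isOpen_posSet (Q : Sym0) (η : ℝ) : IsOpen (posSet Q η) :=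
  isOpen_lt continuous_const (continuous_quad Q)

theorem partitionFn_pos {Q : Sym0} {η : ℝ} (h : (posSet Q η).Nonempty) (l : Sym0) :
    0 < partitionFn Q η l := by
  obtain ⟨p, hp⟩ := h
  refine Continuous.integral_pos_of_hasCompactSupport_nonneg_nonzero (x := p) (by fun_prop)
    (HasCompactSupport.of_compactSpace _) (fun p => by positivity) ?_
  have : 0 < quad Q p - η := sub_pos.2 hp
  rw [max_eq_left this.le]
  positivity

theorem gibbs_eq_div {Q : Sym0} {η : ℝ} (h : (posSet Q η).Nonempty) (l : Sym0) (p : S2) :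
    gibbs Q η l p = Real.exp (quad l p) * max (quad Q p - η) 0 / partitionFn Q η l := by
  rw [gibbs, Real.exp_sub, Real.exp_log (partitionFn_pos h l)]
  ring

theorem integral_gibbs {Q : Sym0} {η : ℝ} (h : (posSet Q η).Nonempty) (l : Sym0) :
    ∫ p, gibbs Q η l p ∂area = 1 := by
  simp only [gibbs_eq_div h]
  rw [integral_div]
  exact div_self (partitionFn_pos h l).ne'

theorem integrable_smul_pointTensor {f : S2 → ℝ} (hf : Integrable f area) :
    Integrable (fun p => f p • pointTensor p) area :=
  hf.smul_bdd 1 continuous_pointTensor.aestronglyMeasurable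
    (Eventually.of_forall norm_pointTensor_le)

theorem integrable_mul_quad {f : S2 → ℝ} (hf : Integrable f area) (A : Sym0) :
    Integrable (fun p => f p * quad A p) area :=
  hf.mul_bdd (c := ‖A‖) (continuous_quad A).aestronglyMeasurable
    (Eventually.of_forall fun p => by simpa using abs_quad_le A p)

/-- Testing the tensor constraint against `A`. -/
theorem integral_mul_quad {f : S2 → ℝ} (hf : Integrable f area) (A : Sym0) :
    ∫ p, f p * quad A p ∂area = inner ℝ A (∫ p, f p • pointTensor p ∂area) := by
  rw [← integral_inner (integrable_smul_pointTensor hf)]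
  exact integral_congr_ae (Eventually.of_forall fun p => by
    simp only [quad_eq_inner]; exact (real_inner_smul_right A (pointTensor p) (f p)).symm)

theorem energy_eq {Q : Sym0} {f : S2 → ℝ} (hf : f ∈ admissible Q) (η : ℝ) :
    energy f η = extIntegral fun p => energyDensity (f p) (quad Q p - η) := by
  unfold energy energyDensity
  congr 1
  ext p
  have : ∫ q, ((inner ℝ p.1 q.1) ^ 2 - 1 / 3) * f q ∂area = quad Q p := by
    simp only [← quad_pointTensor, mul_comm _ (f _)]
    rw [integral_mul_quad hf.1.1, hf.2, real_inner_comm, quad_eq_inner]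
  rw [this]

theorem ae_le_energyDensity {Q : Sym0} {f : S2 → ℝ} (hf : f ∈ admissible Q) (η : ℝ)
    (c : S2 → ℝ) : ∀ᵐ p ∂area,
      ((f p * c p + f p - Real.exp (c p) * max (quad Q p - η) 0 : ℝ) : EReal)
        ≤ energyDensity (f p) (quad Q p - η) :=
  hf.1.2.1.mono fun p hp => le_energyDensity hp (c p) (quad Q p - η)

theorem aemeasurable_integrand {Q : Sym0} {f : S2 → ℝ} (hf : f ∈ admissible Q) (η : ℝ) :
    AEMeasurable (fun p => energyDensity (f p) (quad Q p - η)) area :=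
  aemeasurable_energyDensity hf.1.1.aemeasurable hf.1.2.1 (by fun_prop)

theorem integrable_mul_affine {f : S2 → ℝ} (hf : Integrable f area) (l : Sym0) (r : ℝ) :
    Integrable (fun p => f p * (quad l p - r)) area := by
  simp only [mul_sub]
  exact (integrable_mul_quad hf l).sub (hf.mul_const r)

theorem integral_mul_affine {Q : Sym0} {f : S2 → ℝ} (hf : f ∈ admissible Q) (l : Sym0) (r : ℝ) :
    ∫ p, f p * (quad l p - r) ∂area = inner ℝ l Q - r := by
  simp only [mul_sub]
  rw [integral_sub (integrable_mul_quad hf.1.1 l) (hf.1.1.mul_const r), integral_mul_const,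
    integral_mul_quad hf.1.1, hf.2, hf.1.2.2, one_mul]

/-- The affine minorant of the energy density given by a multiplier `l`, integrated. -/
theorem integral_minorant {Q : Sym0} {η : ℝ} (h : (posSet Q η).Nonempty) {f : S2 → ℝ}
    (hf : f ∈ admissible Q) (l : Sym0) :
    Integrable (fun p => f p * (quad l p - Real.log (partitionFn Q η l)) + f p
      - gibbs Q η l p) area ∧
    ∫ p, (f p * (quad l p - Real.log (partitionFn Q η l)) + f p - gibbs Q η l p) ∂area
      = dualF Q η l := by
  have h1 := integrable_mul_affine hf.1.1 l (Real.log (partitionFn Q η l))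
  have h2 : Integrable (gibbs Q η l) area :=
    integrable_of_continuous (by unfold gibbs; fun_prop)
  refine ⟨(h1.add hf.1.1).sub h2, ?_⟩
  rw [integral_sub (f := fun p => f p * (quad l p - Real.log (partitionFn Q η l)) + f p)
    (h1.add hf.1.1) h2, integral_add h1 hf.1.1, integral_mul_affine hf, hf.1.2.2,
    integral_gibbs h]
  simp only [dualF, partitionFn]
  ring

theorem dualF_le_energy {Q : Sym0} {η : ℝ} (h : (posSet Q η).Nonempty) {f : S2 → ℝ}
    (hf : f ∈ admissible Q) (l : Sym0) : (dualF Q η l : EReal) ≤ energy f η := by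
  obtain ⟨hi, he⟩ := integral_minorant h hf l
  rw [energy_eq hf, ← he]
  exact integral_le_extIntegral hi (ae_le_energyDensity hf η _)

theorem ae_eq_gibbs_of_energy_le {Q : Sym0} {η : ℝ} (h : (posSet Q η).Nonempty) {f : S2 → ℝ}
    (hf : f ∈ admissible Q) {l : Sym0} (hle : energy f η ≤ dualF Q η l) :
    f =ᵐ[area] gibbs Q η l := by
  obtain ⟨hi, he⟩ := integral_minorant h hf l
  rw [energy_eq hf, ← he] at hle
  filter_upwards [hf.1.2.1, ae_eq_of_extIntegral_le hi (aemeasurable_integrand hf η)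
    (ae_le_energyDensity hf η _) hle] with p h0 h1
  exact eq_of_energyDensity_eq h0 h1

theorem energy_gibbs {Q : Sym0} {η : ℝ} {l : Sym0} (hf : gibbs Q η l ∈ admissible Q) :
    energy (gibbs Q η l) η = dualF Q η l := by
  rw [energy_eq hf]
  simp only [gibbs, energyDensity_gibbs]
  change extIntegral (fun p => ((gibbs Q η l p * (quad l p - Real.log (partitionFn Q η l)) : ℝ) :
    EReal)) = _
  rw [extIntegral_coe (integrable_mul_affine hf.1.1 l _), integral_mul_affine hf]
  rfl

/-! ### The domain -/

/-- The pairs `(Q, η)` for which no closed half space of tensors with `Q` on its boundary contains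
the tensors of all points of `E_Q`. This set is the domain of `J`, see `domJ_eq_nondegenerate`. -/
def nondegenerate : Set (Sym0 × ℝ) :=
  {x | ∀ l : Sym0, l ≠ 0 → ∃ p ∈ posSet x.1 x.2, inner ℝ l x.1 < quad l p}

theorem exists_ne_zero : ∃ l : Sym0, l ≠ 0 := by
  refine ⟨pointTensor ⟨EuclideanSpace.single 0 1, by simp⟩, fun h => ?_⟩
  have := congrArg (fun A : Sym0 => A.1 (0, 0)) h
  norm_num [pointTensor] at this

theorem posSet_nonempty {x : Sym0 × ℝ} (hx : x ∈ nondegenerate) :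
    (posSet x.1 x.2).Nonempty := by
  obtain ⟨l, hl⟩ := exists_ne_zero
  obtain ⟨p, hp, -⟩ := hx l hl
  exact ⟨p, hp⟩

/-- A density does not concentrate on a half space of tensors whose boundary contains its own
tensor. -/
theorem not_ae_quad_le {Q : Sym0} {f : S2 → ℝ} (hf : f ∈ admissible Q) {l : Sym0} (hl : l ≠ 0) :
    ¬ ∀ᵐ p ∂area, f p ≠ 0 → quad l p ≤ inner ℝ l Q := by
  intro h
  have hi := integrable_mul_affine hf.1.1 l (inner ℝ l Q)
  have h0 : ∀ᵐ p ∂area, f p * (quad l p - inner ℝ l Q) ≤ 0 := by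
    filter_upwards [h, hf.1.2.1] with p h1 h2
    rcases eq_or_ne (f p) 0 with h3 | h3
    · simp [h3]
    · exact mul_nonpos_of_nonneg_of_nonpos h2 (sub_nonpos.2 (h1 h3))
  have h1 : ∀ᵐ p ∂area, f p * (quad l p - inner ℝ l Q) = 0 := by
    have := (integral_eq_zero_iff_of_nonneg_ae (f := fun p => -(f p * (quad l p - inner ℝ l Q)))
      (h0.mono fun p hp => neg_nonneg.2 hp) hi.neg).1 (by
        rw [integral_neg, integral_mul_affine hf]; simp)
    exact this.mono fun p hp => neg_eq_zero.1 hp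
  have h2 : f =ᵐ[area] 0 := by
    filter_upwards [h1, ae_quad_ne hl (inner ℝ l Q)] with p h3 h4
    exact (mul_eq_zero.1 h3).resolve_right (sub_ne_zero.2 h4)
  have := hf.1.2.2
  rw [integral_congr_ae h2] at this
  simp at this

/-- At a unit eigenvector `p` the value `Q p · p` is the eigenvalue; it exceeds `-1/3` because
`(p · q)² - 1/3 ≥ -1/3` for all `q`, with equality only on a null set. -/
theorem physical_of_admissible {Q : Sym0} {f : S2 → ℝ} (hf : f ∈ admissible Q) :
    Q ∈ physical := by
  intro v hv
  rw [← Matrix.spectrum_toLin', ← Module.End.hasEigenvalue_iff_mem_spectrum] at hv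
  obtain ⟨y, hy⟩ := hv.exists_hasEigenvector
  have hy0 : WithLp.toLp 2 y ≠ 0 := by
    simpa using hy.2
  have hn := norm_pos_iff.2 hy0
  set p : S2 := ⟨(‖WithLp.toLp 2 y‖)⁻¹ • WithLp.toLp 2 y, by
    simp [norm_smul, hn.ne']⟩ with hp
  have hmat : ∀ i, ∑ j, mat Q i j * p.1 j = v * p.1 i := by
    intro i
    have h1 := congrFun hy.apply_eq_smul i
    simp only [Matrix.toLin'_apply, Matrix.mulVec, dotProduct, Pi.smul_apply, smul_eq_mul] at h1
    simp only [hp, PiLp.smul_apply, smul_eq_mul]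
    rw [mul_left_comm, ← h1, Finset.mul_sum]
    exact Finset.sum_congr rfl fun j _ => by ring
  have hq : quad Q p = v := by
    have h2 : ∑ i, p.1 i ^ 2 = 1 := by
      rw [← EuclideanSpace.real_norm_sq_eq, mem_sphere_zero_iff_norm.1 p.2, one_pow]
    calc quad Q p = ∑ i, p.1 i * ∑ j, mat Q i j * p.1 j := by
          simp only [quad, Finset.mul_sum]
          exact Finset.sum_congr rfl fun i _ => Finset.sum_congr rfl fun j _ => by ring
      _ = v * ∑ i, p.1 i ^ 2 := by
          rw [Finset.mul_sum]
          exact Finset.sum_congr rfl fun i _ => by rw [hmat]; ring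
      _ = v := by rw [h2, mul_one]
  by_contra! hle
  have hl : -pointTensor p ≠ 0 := by
    intro h
    have h1 := quad_pointTensor p p
    rw [neg_eq_zero.1 h, real_inner_self_eq_norm_sq, mem_sphere_zero_iff_norm.1 p.2] at h1
    norm_num [quad_eq_inner] at h1
  refine not_ae_quad_le hf hl (Eventually.of_forall fun q _ => ?_)
  have h1 := quad_pointTensor p q
  rw [quad_eq_inner] at hq h1
  rw [quad_eq_inner, inner_neg_left, inner_neg_left, h1, real_inner_comm Q (pointTensor p), hq]
  nlinarith [sq_nonneg (inner ℝ q.1 p.1), sq_nonneg (inner ℝ p.1 q.1)]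

theorem domJ_subset_nondegenerate : domJ ⊆ nondegenerate := by
  rintro ⟨Q, η⟩ ⟨-, hJ⟩ l hl
  simp only [auxJ, iInf_lt_iff] at hJ
  obtain ⟨f, hf, hlt⟩ := hJ
  rw [energy_eq hf] at hlt
  -- Any exponent gives an integrable minorant of the energy density; `0` is the simplest one.
  have hi : Integrable (fun p => f p * 0 + f p - Real.exp 0 * max (quad Q p - η) 0) area := by
    simp only [mul_zero, zero_add]
    exact hf.1.1.sub (integrable_of_continuous (by fun_prop))
  have htop := ae_ne_top_of_extIntegral_lt_top hi (aemeasurable_integrand hf η)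
    (ae_le_energyDensity hf η fun _ => 0) hlt
  by_contra! hcon
  refine not_ae_quad_le hf hl ?_
  filter_upwards [htop, hf.1.2.1] with p h1 h2 h3
  refine hcon p (show η < quad Q p from not_le.1 fun h4 => h1 ?_)
  exact energyDensity_eq_top (lt_of_le_of_ne h2 h3.symm) (sub_nonpos.2 h4)

/-- The condition only has to be tested on the compact unit sphere of multipliers, on which it is
stable under small perturbations. -/
theorem isOpen_nondegenerate : IsOpen nondegenerate := by
  rw [isOpen_iff_mem_nhds]
  intro x hx
  have hloc : ∀ l ∈ Metric.sphere (0 : Sym0) 1, ∀ᶠ z : (Sym0 × ℝ) × Sym0 in 𝓝 (x, l),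
      ∃ p ∈ posSet z.1.1 z.1.2, inner ℝ z.2 z.1.1 < quad z.2 p := by
    intro l hl
    obtain ⟨p, hp, hlt⟩ := hx l (ne_zero_of_mem_unit_sphere ⟨l, hl⟩)
    simp only [quad_eq_inner] at hlt
    have h1 : ∀ᶠ z : (Sym0 × ℝ) × Sym0 in 𝓝 (x, l), z.1.2 < inner ℝ z.1.1 (pointTensor p) :=
      ContinuousAt.eventually_lt (by fun_prop) (by fun_prop) (by rw [← quad_eq_inner]; exact hp)
    have h2 : ∀ᶠ z : (Sym0 × ℝ) × Sym0 in 𝓝 (x, l),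
        inner ℝ z.2 z.1.1 < inner ℝ z.2 (pointTensor p) :=
      ContinuousAt.eventually_lt (by fun_prop) (by fun_prop) hlt
    filter_upwards [h1, h2] with z h1 h2
    exact ⟨p, show _ < quad _ _ by rwa [quad_eq_inner], by rwa [quad_eq_inner]⟩
  filter_upwards [(isCompact_sphere (0 : Sym0) 1).eventually_forall_of_forall_eventually
    (P := fun x l => ∃ p ∈ posSet x.1 x.2, inner ℝ l x.1 < quad l p) hloc] with y hy l hl
  obtain ⟨p, hp, hlt⟩ := hy (‖l‖⁻¹ • l) (by simp [norm_smul, hl])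
  refine ⟨p, hp, ?_⟩
  rw [quad_eq_inner, inner_smul_sym0, inner_smul_sym0] at hlt
  rw [quad_eq_inner]
  exact lt_of_mul_lt_mul_left hlt (by positivity)

/-! ### The dual problem -/

theorem continuous_partitionFn :
    Continuous fun z : (Sym0 × ℝ) × Sym0 => partitionFn z.1.1 z.1.2 z.2 := by
  unfold partitionFn
  have : Continuous (Function.uncurry fun (z : (Sym0 × ℝ) × Sym0) (p : S2) =>
      Real.exp (quad z.2 p) * max (quad z.1.1 p - z.1.2) 0) := by
    simp only [quad_eq_inner, Function.uncurry_def]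
    fun_prop
  simpa using continuous_parametric_integral_of_continuous (μ := area) this isCompact_univ

theorem continuousAt_dualF {x : Sym0 × ℝ} (hx : x ∈ nondegenerate) (l : Sym0) :
    ContinuousAt (fun z : (Sym0 × ℝ) × Sym0 => dualF z.1.1 z.1.2 z.2) (x, l) := by
  unfold dualF
  have h := continuous_partitionFn.continuousAt (x := (x, l))
  exact ContinuousAt.sub (by fun_prop) (h.log (partitionFn_pos (posSet_nonempty hx) l).ne')

/-- Near one direction `l₀` of multipliers the dual objective function decreases linearly: the
exponential weight is large on a neighbourhood of a point of `E_Q` given by nondegeneracy. -/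
theorem exists_dualF_smul_le {x : Sym0 × ℝ} (hx : x ∈ nondegenerate) {l₀ : Sym0} (hl₀ : l₀ ≠ 0) :
    ∃ s ∈ 𝓝 l₀, ∃ δ > 0, ∃ C : ℝ, ∀ᶠ y in 𝓝 x, ∀ l ∈ s, ∀ t : ℝ, 0 ≤ t →
      dualF y.1 y.2 (t • l) ≤ C - δ * t := by
  obtain ⟨p, hp, hlt⟩ := hx l₀ hl₀
  obtain ⟨δ, hδ, hδ1, hδ2⟩ : ∃ δ > 0, x.2 + δ < quad x.1 p ∧ inner ℝ l₀ x.1 + δ < quad l₀ p := by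
    have h1 : 0 < quad x.1 p - x.2 := sub_pos.2 hp
    have h2 := sub_pos.2 hlt
    refine ⟨min (quad x.1 p - x.2) (quad l₀ p - inner ℝ l₀ x.1) / 2, by positivity, ?_, ?_⟩
    · linarith [min_le_left (quad x.1 p - x.2) (quad l₀ p - inner ℝ l₀ x.1)]
    · linarith [min_le_right (quad x.1 p - x.2) (quad l₀ p - inner ℝ l₀ x.1)]
  rw [quad_eq_inner] at hδ1 hδ2
  have e1 : ∀ᶠ z : ((Sym0 × ℝ) × Sym0) × S2 in 𝓝 ((x, l₀), p),
      z.1.1.2 + δ < inner ℝ z.1.1.1 (pointTensor z.2) :=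
    ContinuousAt.eventually_lt (by fun_prop) (by fun_prop) hδ1
  have e2 : ∀ᶠ z : ((Sym0 × ℝ) × Sym0) × S2 in 𝓝 ((x, l₀), p),
      inner ℝ z.1.2 z.1.1.1 + δ < inner ℝ z.1.2 (pointTensor z.2) :=
    ContinuousAt.eventually_lt (by fun_prop) (by fun_prop) hδ2
  have e3 := e1.and e2
  rw [nhds_prod_eq, nhds_prod_eq] at e3
  obtain ⟨S, hS, U₀, hU₀, hSU⟩ := Filter.mem_prod_iff.1 e3
  obtain ⟨V, hV, s, hs, hVs⟩ := Filter.mem_prod_iff.1 hS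
  obtain ⟨U, hU, hUo, hpU⟩ := mem_nhds_iff.1 hU₀
  have hm : 0 < area.real U :=
    ENNReal.toReal_pos (hUo.measure_pos area ⟨p, hpU⟩).ne' (measure_ne_top _ _)
  refine ⟨s, hs, δ, hδ, -Real.log (area.real U * δ), ?_⟩
  filter_upwards [hV] with y hy l hl t ht
  have hint : Integrable (fun q => Real.exp (quad (t • l) q) * max (quad y.1 q - y.2) 0) area :=
    integrable_of_continuous (by fun_prop)
  -- On `U` the exponent `t (l · T)` exceeds `t (l · Q)` by at least `t δ`, and the weight is `≥ δ`.
  have hZ : area.real U * (Real.exp (t * (inner ℝ l y.1 + δ)) * δ)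
      ≤ partitionFn y.1 y.2 (t • l) := by
    refine le_trans ?_ (setIntegral_le_integral (s := U) hint
      (Eventually.of_forall fun q => by positivity))
    refine setIntegral_ge_of_const_le hUo.measurableSet (measure_ne_top _ _) (fun q hq => ?_)
      hint.integrableOn
    obtain ⟨h1, h2⟩ := @hSU ((y, l), q) ⟨hVs ⟨hy, hl⟩, hU hq⟩
    simp only at h1 h2
    refine mul_le_mul (Real.exp_le_exp.2 ?_) (le_max_of_le_left ?_) hδ.le (Real.exp_pos _).le
    · rw [quad_eq_inner, inner_smul_sym0]
      exact mul_le_mul_of_nonneg_left h2.le ht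
    · rw [quad_eq_inner]; linarith
  have hlog := Real.log_le_log (by positivity) hZ
  rw [mul_left_comm, Real.log_mul (Real.exp_pos _).ne' (by positivity), Real.log_exp] at hlog
  change inner ℝ (t • l) y.1 - Real.log (partitionFn y.1 y.2 (t • l)) ≤ _
  rw [inner_smul_sym0]
  linarith

/-- Bounds of linear decay in a parameter `t`, given near each point of a compact set, hold
uniformly on it. -/
theorem _root_.IsCompact.exists_forall_le_sub_mul {X Y : Type*} [TopologicalSpace X]
    [TopologicalSpace Y] {K : Set Y} (hK : IsCompact K) {x : X} {G : X → Y → ℝ → ℝ}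
    (h : ∀ l ∈ K, ∃ s ∈ 𝓝 l, ∃ δ > 0, ∃ C : ℝ, ∀ᶠ y in 𝓝 x, ∀ l ∈ s, ∀ t : ℝ, 0 ≤ t →
      G y l t ≤ C - δ * t) :
    ∃ δ > 0, ∃ C : ℝ, ∀ᶠ y in 𝓝 x, ∀ l ∈ K, ∀ t : ℝ, 0 ≤ t → G y l t ≤ C - δ * t := by
  refine hK.induction_on (p := fun s => ∃ δ > 0, ∃ C : ℝ,
    ∀ᶠ y in 𝓝 x, ∀ l ∈ s, ∀ t : ℝ, 0 ≤ t → G y l t ≤ C - δ * t)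
    ⟨1, one_pos, 0, by simp⟩ ?_ ?_ ?_
  · rintro s t hst ⟨δ, hδ, C, h⟩
    exact ⟨δ, hδ, C, h.mono fun y hy l hl => hy l (hst hl)⟩
  · rintro s t ⟨δ, hδ, C, h⟩ ⟨δ', hδ', C', h'⟩
    refine ⟨min δ δ', lt_min hδ hδ', max C C', ?_⟩
    filter_upwards [h, h'] with y hy hy' l hl r hr
    rcases hl with hl | hl
    · refine (hy l hl r hr).trans (sub_le_sub (le_max_left _ _) ?_)
      exact mul_le_mul_of_nonneg_right (min_le_left _ _) hr
    · refine (hy' l hl r hr).trans (sub_le_sub (le_max_right _ _) ?_)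
      exact mul_le_mul_of_nonneg_right (min_le_right _ _) hr
  · intro l hl
    obtain ⟨s, hs, hP⟩ := h l hl
    exact ⟨s, mem_nhdsWithin_of_mem_nhds hs, hP⟩

/-- The dual objective function is coercive, uniformly near a nondegenerate pair. -/
theorem exists_dualF_le {x : Sym0 × ℝ} (hx : x ∈ nondegenerate) :
    ∃ δ > 0, ∃ C : ℝ, ∀ᶠ y in 𝓝 x, ∀ l : Sym0, dualF y.1 y.2 l ≤ C - δ * ‖l‖ := by
  have hloc : ∀ l ∈ Metric.sphere (0 : Sym0) 1, ∃ s ∈ 𝓝 l, ∃ δ > 0, ∃ C : ℝ, ∀ᶠ y in 𝓝 x,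
      ∀ l ∈ s, ∀ t : ℝ, 0 ≤ t → dualF y.1 y.2 (t • l) ≤ C - δ * t := fun l hl =>
    exists_dualF_smul_le hx (ne_zero_of_mem_unit_sphere ⟨l, hl⟩)
  obtain ⟨δ, hδ, C, h⟩ := (isCompact_sphere (0 : Sym0) 1).exists_forall_le_sub_mul hloc
  obtain ⟨l₁, hl₁⟩ := exists_ne_zero
  refine ⟨δ, hδ, C, h.mono fun y hy l => ?_⟩
  rcases eq_or_ne l 0 with rfl | hl
  · simpa using hy (‖l₁‖⁻¹ • l₁) (by simp [norm_smul, hl₁]) 0 le_rfl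
  · have := hy (‖l‖⁻¹ • l) (by simp [norm_smul, hl]) ‖l‖ (norm_nonneg l)
    rwa [smul_inv_smul₀ (norm_ne_zero_iff.2 hl)] at this

theorem exists_isDualMaximiser {x : Sym0 × ℝ} (hx : x ∈ nondegenerate) :
    ∃ L, IsDualMaximiser x.1 x.2 L := by
  obtain ⟨δ, hδ, C, h⟩ := exists_dualF_le hx
  have hc : Continuous (dualF x.1 x.2) := continuous_iff_continuousAt.2 fun l =>
    ContinuousAt.comp (f := fun l => (x, l)) (continuousAt_dualF hx l)
      (Continuous.prodMk_right x).continuousAt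
  refine hc.exists_forall_ge' 0 ?_
  have hlim : Tendsto (fun l : Sym0 => δ * ‖l‖) (cocompact Sym0) atTop :=
    (tendsto_norm_cocompact_atTop (E := Sym0)).const_mul_atTop hδ
  filter_upwards [hlim.eventually_ge_atTop (C - dualF x.1 x.2 0)] with l hl
  linarith [h.self_of_nhds l]

/-- The first-order condition of the dual problem: the Gibbs density of a maximiser has the
prescribed tensor. -/
theorem gibbs_mem_admissible {Q : Sym0} {η : ℝ} (h : (posSet Q η).Nonempty) {L : Sym0}
    (hL : IsDualMaximiser Q η L) : gibbs Q η L ∈ admissible Q := by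
  have hi : Integrable (gibbs Q η L) area := by
    exact integrable_of_continuous (by unfold gibbs; fun_prop)
  refine ⟨⟨hi, Eventually.of_forall fun p => by unfold gibbs; positivity, integral_gibbs h L⟩, ?_⟩
  refine ext_inner_left ℝ fun A => ?_
  rw [← integral_mul_quad hi]
  have hder : HasDerivAt (fun t : ℝ => partitionFn Q η (L + t • A))
      (∫ p, Real.exp (quad L p + 0 * quad A p) * quad A p * max (quad Q p - η) 0 ∂area) 0 := by
    have hq : ∀ t p, quad (L + t • A) p = quad L p + t * quad A p := by
      intro t p
      simp only [quad_eq_inner]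
      rw [inner_add_left, inner_smul_sym0]
    simp only [partitionFn, hq]
    refine (hasDerivAt_integral_of_dominated_loc_of_deriv_le (s := Metric.ball 0 1)
      (F := fun t p => Real.exp (quad L p + t * quad A p) * max (quad Q p - η) 0)
      (F' := fun t p => Real.exp (quad L p + t * quad A p) * quad A p * max (quad Q p - η) 0)
      (bound := fun p => Real.exp (|quad L p| + |quad A p|) * |quad A p| * max (quad Q p - η) 0)
      (Metric.ball_mem_nhds 0 one_pos) (Eventually.of_forall fun t => ?_) ?_ ?_
      (Eventually.of_forall fun p t ht => ?_) ?_ (Eventually.of_forall fun p t _ => ?_)).2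
    · exact Continuous.aestronglyMeasurable (by fun_prop)
    · exact integrable_of_continuous (by fun_prop)
    · exact Continuous.aestronglyMeasurable (by fun_prop)
    · rw [norm_mul, norm_mul, Real.norm_eq_abs, Real.norm_eq_abs, Real.norm_eq_abs, Real.abs_exp,
        abs_of_nonneg (le_max_right (quad Q p - η) 0)]
      gcongr
      · exact le_abs_self _
      · have h1 : |t| ≤ 1 := by
          rw [← Real.norm_eq_abs]; exact (mem_ball_zero_iff.1 ht).le
        calc t * quad A p ≤ |t| * |quad A p| := by rw [← abs_mul]; exact le_abs_self _
          _ ≤ 1 * |quad A p| := by gcongr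
          _ = |quad A p| := one_mul _
    · exact integrable_of_continuous (by fun_prop)
    · have h1 : HasDerivAt (fun t => quad L p + t * quad A p) (quad A p) t := by
        simpa using ((hasDerivAt_id t).mul_const (quad A p)).const_add (quad L p)
      exact h1.exp.mul_const _
  have hZ := partitionFn_pos h L
  have hL0 : L + (0 : ℝ) • A = L := by simp
  have hder2 : HasDerivAt (fun t : ℝ => dualF Q η (L + t • A)) (inner ℝ A Q
      - (∫ p, Real.exp (quad L p + 0 * quad A p) * quad A p * max (quad Q p - η) 0 ∂area)
        / partitionFn Q η L) 0 := by
    have h1 := hder.log (by rw [hL0]; exact hZ.ne')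
    rw [hL0] at h1
    refine HasDerivAt.sub ?_ h1
    have h2 : ∀ t : ℝ, inner ℝ (L + t • A) Q = inner ℝ L Q + t * inner ℝ A Q := by
      intro t
      rw [inner_add_left, inner_smul_sym0]
    simp only [h2]
    simpa using ((hasDerivAt_id (0 : ℝ)).mul_const (inner ℝ A Q)).const_add (inner ℝ L Q)
  have hmax : IsLocalMax (fun t : ℝ => dualF Q η (L + t • A)) 0 :=
    Eventually.of_forall fun t => by simpa only [hL0] using hL (L + t • A)
  have h0 := hmax.hasDerivAt_eq_zero hder2
  rw [sub_eq_zero] at h0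
  rw [h0, ← integral_div]
  refine integral_congr_ae (Eventually.of_forall fun p => ?_)
  simp only [gibbs_eq_div h]
  ring_nf

/-- Two maximisers have the same Gibbs density, by uniqueness of the minimiser of the energy. -/
theorem IsDualMaximiser.unique {x : Sym0 × ℝ} (hx : x ∈ nondegenerate) {L L' : Sym0}
    (hL : IsDualMaximiser x.1 x.2 L) (hL' : IsDualMaximiser x.1 x.2 L') : L = L' := by
  have h := posSet_nonempty hx
  have hf := gibbs_mem_admissible h hL
  have hae := ae_eq_gibbs_of_energy_le h hf (l := L')
    (by rw [energy_gibbs hf]; exact EReal.coe_le_coe_iff.2 (hL' L))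
  by_contra hne
  -- Equality of the Gibbs densities makes `quad (L - L')` constant almost everywhere on `E_Q`.
  have h0 : ∀ᵐ p ∂area, p ∉ posSet x.1 x.2 := by
    filter_upwards [hae, ae_quad_ne (sub_ne_zero.2 hne)
      (Real.log (partitionFn x.1 x.2 L) - Real.log (partitionFn x.1 x.2 L'))] with p h1 h2 hp
    apply h2
    have hw : 0 < quad x.1 p - x.2 := sub_pos.2 hp
    rw [gibbs, gibbs, max_eq_left hw.le] at h1
    have h3 := Real.exp_injective (mul_right_cancel₀ hw.ne' h1)
    simp only [quad_eq_inner] at h3 ⊢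
    rw [inner_sub_left]
    linarith
  exact ((isOpen_posSet x.1 x.2).measure_pos area h).ne' (by simpa [ae_iff] using h0)

theorem isOptimal_gibbs {Q : Sym0} {η : ℝ} (h : (posSet Q η).Nonempty) {L : Sym0}
    (hL : IsDualMaximiser Q η L) : IsOptimal Q η (gibbs Q η L) := by
  have hf := gibbs_mem_admissible h hL
  refine ⟨hf, fun g hg => ?_⟩
  rw [energy_gibbs hf]
  exact dualF_le_energy h hg L

theorem IsOptimal.ae_eq_gibbs {Q : Sym0} {η : ℝ} (h : (posSet Q η).Nonempty) {L : Sym0}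
    (hL : IsDualMaximiser Q η L) {f : S2 → ℝ} (hf : IsOptimal Q η f) :
    f =ᵐ[area] gibbs Q η L := by
  have hg := gibbs_mem_admissible h hL
  exact ae_eq_gibbs_of_energy_le h hf.1 ((hf.2 _ hg).trans_eq (energy_gibbs hg))

/-- Strong duality. -/
theorem auxJ_eq_dualF {Q : Sym0} {η : ℝ} (h : (posSet Q η).Nonempty) {L : Sym0}
    (hL : IsDualMaximiser Q η L) : auxJ Q η = dualF Q η L := by
  have hf := gibbs_mem_admissible h hL
  exact le_antisymm ((iInf₂_le _ hf).trans_eq (energy_gibbs hf))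
    (le_iInf₂ fun g hg => dualF_le_energy h hg L)

theorem domJ_eq_nondegenerate : domJ = nondegenerate := by
  refine domJ_subset_nondegenerate.antisymm fun x hx => ?_
  obtain ⟨L, hL⟩ := exists_isDualMaximiser hx
  have h := posSet_nonempty hx
  refine ⟨physical_of_admissible (gibbs_mem_admissible h hL), ?_⟩
  rw [auxJ_eq_dualF h hL]
  exact EReal.coe_lt_top _

/-! ### Envelope theorem -/

/-- Under a unique maximiser and confinement of the maximisers to a compact set, a choice of
maximisers is continuous. -/
theorem continuousAt_of_forall_le_of_forall_lt {X Y : Type*} [TopologicalSpace X]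
    [TopologicalSpace Y] {G : X → Y → ℝ} {Λ : X → Y} {x₀ : X} {K : Set Y} (hK : IsCompact K)
    (hG : ∀ l, ContinuousAt (fun z : X × Y => G z.1 z.2) (x₀, l))
    (hΛK : ∀ᶠ x in 𝓝 x₀, Λ x ∈ K) (hΛ : ∀ᶠ x in 𝓝 x₀, ∀ l, G x l ≤ G x (Λ x))
    (huniq : ∀ l, l ≠ Λ x₀ → G x₀ l < G x₀ (Λ x₀)) : ContinuousAt Λ x₀ := by
  rw [ContinuousAt, tendsto_def]
  intro V hV
  obtain ⟨U, hUV, hU, hxU⟩ := mem_nhds_iff.1 hV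
  have hloc : ∀ l ∈ K \ U, ∀ᶠ z : X × Y in 𝓝 (x₀, l), G z.1 z.2 < G z.1 (Λ x₀) := by
    rintro l ⟨-, hl⟩
    have hc : ContinuousAt (fun z : X × Y => G z.1 (Λ x₀)) (x₀, l) :=
      ContinuousAt.comp (x := (x₀, l)) (f := fun z : X × Y => (z.1, Λ x₀))
        (g := fun z : X × Y => G z.1 z.2) (hG (Λ x₀)) (by fun_prop)
    exact (hG l).eventually_lt hc (huniq l fun h => hl (h ▸ hxU))
  filter_upwards [(hK.diff hU).eventually_forall_of_forall_eventually
    (P := fun x l => G x l < G x (Λ x₀)) hloc, hΛK, hΛ] with x h1 h2 h3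
  refine hUV ?_
  by_contra h4
  exact (h1 _ ⟨h2, h4⟩).not_ge (h3 _)

/-- The envelope (Danskin) theorem: the derivative of a value function is the partial derivative of
the objective at the maximiser, which only has to depend continuously on the parameter. -/
theorem hasFDerivAt_of_forall_le {E Y : Type*} [NormedAddCommGroup E] [NormedSpace ℝ E]
    [TopologicalSpace Y] {G : E → Y → ℝ} {G' : E → Y → E →L[ℝ] ℝ} {Λ : E → Y} {x₀ : E}
    (hG : ∀ᶠ z : E × Y in 𝓝 (x₀, Λ x₀), HasFDerivAt (fun x => G x z.2) (G' z.1 z.2) z.1)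
    (hG' : ContinuousAt (fun z : E × Y => G' z.1 z.2) (x₀, Λ x₀)) (hΛc : ContinuousAt Λ x₀)
    (hΛ : ∀ᶠ x in 𝓝 x₀, ∀ l, G x l ≤ G x (Λ x)) :
    HasFDerivAt (fun x => G x (Λ x)) (G' x₀ (Λ x₀)) x₀ := by
  rw [hasFDerivAt_iff_isLittleO, Asymptotics.isLittleO_iff]
  intro ε hε
  have h1 : ∀ᶠ z : E × Y in 𝓝 (x₀, Λ x₀), ‖G' z.1 z.2 - G' x₀ (Λ x₀)‖ ≤ ε := by
    filter_upwards [hG' (Metric.ball_mem_nhds _ hε)] with z hz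
    exact (mem_ball_iff_norm.1 hz).le
  have h2 := hG.and h1
  rw [nhds_prod_eq] at h2
  obtain ⟨S, hS, V, hV, hSV⟩ := Filter.mem_prod_iff.1 h2
  obtain ⟨r, hr, hrS⟩ := Metric.mem_nhds_iff.1 hS
  -- The mean value inequality in the parameter, uniformly in multipliers near `Λ x₀`.
  have hmv : ∀ x ∈ Metric.ball x₀ r, ∀ l ∈ V,
      |G x l - G x₀ l - G' x₀ (Λ x₀) (x - x₀)| ≤ ε * ‖x - x₀‖ := by
    intro x hx l hl
    have hz : ∀ y ∈ Metric.ball x₀ r, _ := fun y hy => @hSV (y, l) ⟨hrS hy, hl⟩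
    exact (convex_ball x₀ r).norm_image_sub_le_of_norm_hasFDerivWithin_le' (f := fun x => G x l)
      (f' := fun x => G' x l) (fun y hy => (hz y hy).1.hasFDerivWithinAt)
      (fun y hy => (hz y hy).2) (Metric.mem_ball_self hr) hx
  have hmax₀ := hΛ.self_of_nhds
  filter_upwards [Metric.ball_mem_nhds x₀ hr, hΛc hV, hΛ] with x hx hxV hmax
  have a1 := abs_le.1 (hmv x hx (Λ x) hxV)
  have a2 := abs_le.1 (hmv x hx (Λ x₀) (mem_of_mem_nhds hV))
  rw [Real.norm_eq_abs, abs_le]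
  constructor <;> linarith [hmax (Λ x₀), hmax₀ (Λ x)]

/-! ### Differentiability of the value function

The dual objective function is differentiated for an arbitrary bounded family of tensors `T p` in
an inner product space. -/

section ValueFunction

-- Needed to find the normed structure on the continuous linear maps `V × ℝ →L[ℝ] ℝ`.
set_option maxSynthPendingDepth 3

variable {V S : Type*} [NormedAddCommGroup V] [InnerProductSpace ℝ V] [TopologicalSpace S]

/-- The linear functional `(Q, η) ↦ Q · v - η`. -/
noncomputable def affineForm (v : V) : V × ℝ →L[ℝ] ℝ :=
  (innerSL ℝ v).comp (ContinuousLinearMap.fst ℝ V ℝ) - ContinuousLinearMap.snd ℝ V ℝ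

theorem affineForm_apply (v : V) (x : V × ℝ) : affineForm v x = inner ℝ x.1 v - x.2 := by
  rw [real_inner_comm]
  rfl

theorem norm_affineForm_le (v : V) : ‖affineForm v‖ ≤ ‖v‖ + 1 := by
  refine ContinuousLinearMap.opNorm_le_bound _ (by positivity) fun x => ?_
  rw [affineForm_apply, Real.norm_eq_abs]
  calc |inner ℝ x.1 v - x.2| ≤ |inner ℝ x.1 v| + |x.2| := abs_sub _ _
    _ ≤ ‖x.1‖ * ‖v‖ + ‖x‖ := add_le_add (abs_real_inner_le_norm _ _) (norm_snd_le x)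
    _ ≤ ‖x‖ * ‖v‖ + ‖x‖ := by gcongr; exact norm_fst_le x
    _ = (‖v‖ + 1) * ‖x‖ := by ring

@[fun_prop]
theorem continuous_affineForm : Continuous (affineForm : V → V × ℝ →L[ℝ] ℝ) := by
  unfold affineForm
  fun_prop

theorem isOpen_affineForm_pos {T : S → V} (hT : Continuous T) (x : V × ℝ) :
    IsOpen {p | 0 < affineForm (T p) x} :=
  isOpen_lt continuous_const (by fun_prop)

variable [MeasurableSpace S]

/-- The partition function of a family `T` of tensors. -/
noncomputable def familyPartition (μ : Measure S) (T : S → V) (x : V × ℝ) (l : V) : ℝ :=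
  ∫ p, Real.exp (inner ℝ l (T p)) * max (affineForm (T p) x) 0 ∂μ

/-- The derivative of `familyPartition` in `(Q, η)`. -/
noncomputable def familyPartitionDeriv (μ : Measure S) (T : S → V) (x : V × ℝ) (l : V) :
    V × ℝ →L[ℝ] ℝ :=
  ∫ p in {p | 0 < affineForm (T p) x}, Real.exp (inner ℝ l (T p)) • affineForm (T p) ∂μ

/-- The dual objective function of a family `T` of tensors. -/
noncomputable def familyDual (μ : Measure S) (T : S → V) (x : V × ℝ) (l : V) : ℝ :=
  inner ℝ l x.1 - Real.log (familyPartition μ T x l)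

/-- The derivative of `familyDual` in `(Q, η)`. -/
noncomputable def familyDualDeriv (μ : Measure S) (T : S → V) (x : V × ℝ) (l : V) :
    V × ℝ →L[ℝ] ℝ :=
  (innerSL ℝ l).comp (ContinuousLinearMap.fst ℝ V ℝ)
    - (familyPartition μ T x l)⁻¹ • familyPartitionDeriv μ T x l

variable {μ : Measure S} {T : S → V} [BorelSpace S]

theorem familyPartitionDeriv_eq (hT : Continuous T) (x : V × ℝ) (l : V) :
    familyPartitionDeriv μ T x l = ∫ p, (if 0 < affineForm (T p) x then
      Real.exp (inner ℝ l (T p)) • affineForm (T p) else 0) ∂μ := by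
  rw [familyPartitionDeriv, ← integral_indicator (isOpen_affineForm_pos hT x).measurableSet]
  rfl

theorem aestronglyMeasurable_deriv_integrand [SecondCountableTopology S]
    (hT : Continuous T) (x : V × ℝ) (l : V) :
    AEStronglyMeasurable (fun p => if 0 < affineForm (T p) x then
      Real.exp (inner ℝ l (T p)) • affineForm (T p) else 0) μ :=
  (StronglyMeasurable.ite (isOpen_affineForm_pos hT x).measurableSet
    (Continuous.stronglyMeasurable (by fun_prop)) stronglyMeasurable_const).aestronglyMeasurable

variable [IsFiniteMeasure μ]

/-- The positive part `max (affineForm (T p) x) 0` is not differentiable in `x` only on the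
boundary of the positivity set, where `affineForm (T p) x = 0`; this boundary is assumed null. -/
theorem hasFDerivAt_familyPartition [CompactSpace S] [SecondCountableTopology S]
    (hT : Continuous T) {x : V × ℝ}
    (hx : ∀ᵐ p ∂μ, affineForm (T p) x ≠ 0) (l : V) :
    HasFDerivAt (fun y => familyPartition μ T y l) (familyPartitionDeriv μ T x l) x := by
  simp only [familyPartition]
  rw [familyPartitionDeriv_eq hT]
  refine (hasFDerivAt_integral_of_dominated_loc_of_lip (s := univ)
    (F := fun y p => Real.exp (inner ℝ l (T p)) * max (affineForm (T p) y) 0)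
    (bound := fun p => Real.exp (inner ℝ l (T p)) * (‖T p‖ + 1)) univ_mem
    (Eventually.of_forall fun y => Continuous.aestronglyMeasurable (by fun_prop))
    (integrable_of_continuous (by fun_prop)) (aestronglyMeasurable_deriv_integrand hT x l)
    (Eventually.of_forall fun p => ?_) (integrable_of_continuous (by fun_prop)) ?_).2
  · refine LipschitzOnWith.of_dist_le_mul fun y _ z _ => ?_
    rw [Real.coe_nnabs, abs_of_nonneg (by positivity), Real.dist_eq, ← mul_sub, abs_mul,
      Real.abs_exp, mul_assoc, dist_eq_norm]
    refine mul_le_mul_of_nonneg_left ?_ (Real.exp_pos _).le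
    refine (abs_max_sub_max_le_abs _ _ _).trans ?_
    rw [← map_sub, ← Real.norm_eq_abs]
    exact (affineForm (T p)).le_of_opNorm_le (norm_affineForm_le (T p)) _
  · filter_upwards [hx] with p hp
    have hc : ContinuousAt (fun y => affineForm (T p) y) x := by fun_prop
    rcases hp.lt_or_gt with h | h
    · rw [if_neg h.not_gt]
      refine (hasFDerivAt_const (0 : ℝ) x).congr_of_eventuallyEq ?_
      filter_upwards [hc.eventually_lt continuousAt_const h] with y hy
      rw [max_eq_right hy.le, mul_zero]
    · rw [if_pos h]
      refine ((affineForm (T p)).hasFDerivAt.const_mul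
        (Real.exp (inner ℝ l (T p)))).congr_of_eventuallyEq ?_
      filter_upwards [continuousAt_const.eventually_lt hc h] with y hy
      rw [max_eq_left hy.le]

theorem continuousAt_familyPartitionDeriv [SecondCountableTopology S]
    (hT : Continuous T) (hT1 : ∀ p, ‖T p‖ ≤ 1) {x : V × ℝ}
    (hx : ∀ᵐ p ∂μ, affineForm (T p) x ≠ 0) (l : V) :
    ContinuousAt (fun z : (V × ℝ) × V => familyPartitionDeriv μ T z.1 z.2) (x, l) := by
  simp only [familyPartitionDeriv_eq hT]
  refine continuousAt_of_dominated (bound := fun _ => Real.exp (‖l‖ + 1) * 2)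
    (Eventually.of_forall fun z => aestronglyMeasurable_deriv_integrand hT z.1 z.2) ?_
    (integrable_const _) ?_
  · have : ∀ᶠ z : (V × ℝ) × V in 𝓝 (x, l), ‖z.2‖ < ‖l‖ + 1 :=
      ContinuousAt.eventually_lt (by fun_prop) (by fun_prop) (lt_add_one _)
    filter_upwards [this] with z hz
    refine Eventually.of_forall fun p => ?_
    split_ifs
    · have h1 : inner ℝ z.2 (T p) ≤ ‖l‖ + 1 :=
        calc inner ℝ z.2 (T p) ≤ ‖z.2‖ * ‖T p‖ := real_inner_le_norm _ _
          _ ≤ ‖z.2‖ * 1 := by gcongr; exact hT1 p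
          _ ≤ ‖l‖ + 1 := by linarith
      rw [norm_smul, Real.norm_eq_abs, Real.abs_exp]
      exact mul_le_mul (Real.exp_le_exp.2 h1)
        ((norm_affineForm_le (T p)).trans (by linarith [hT1 p])) (norm_nonneg _)
        (Real.exp_pos _).le
    · rw [norm_zero]; positivity
  · filter_upwards [hx] with p hp
    have hc : ContinuousAt (fun z : (V × ℝ) × V => affineForm (T p) z.1) (x, l) := by fun_prop
    rcases hp.lt_or_gt with h | h
    · refine (continuousAt_const (y := (0 : V × ℝ →L[ℝ] ℝ))).congr ?_
      filter_upwards [hc.eventually_lt continuousAt_const h] with z hz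
      rw [if_neg hz.not_gt]
    · have h1 : ContinuousAt (fun z : (V × ℝ) × V =>
          Real.exp (inner ℝ z.2 (T p)) • affineForm (T p)) (x, l) := by
        fun_prop
      refine h1.congr ?_
      filter_upwards [continuousAt_const.eventually_lt hc h] with z hz
      rw [if_pos hz]

theorem hasFDerivAt_familyDual [CompactSpace S] [SecondCountableTopology S]
    (hT : Continuous T) {x : V × ℝ}
    (hx : ∀ᵐ p ∂μ, affineForm (T p) x ≠ 0) {l : V} (hZ : familyPartition μ T x l ≠ 0) :
    HasFDerivAt (fun y => familyDual μ T y l) (familyDualDeriv μ T x l) x :=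
  ((innerSL ℝ l).comp (ContinuousLinearMap.fst ℝ V ℝ)).hasFDerivAt.sub
    ((hasFDerivAt_familyPartition hT hx l).log hZ)

theorem continuousAt_familyDualDeriv [SecondCountableTopology S]
    (hT : Continuous T) (hT1 : ∀ p, ‖T p‖ ≤ 1) {x : V × ℝ}
    (hx : ∀ᵐ p ∂μ, affineForm (T p) x ≠ 0) {l : V} (hZ : familyPartition μ T x l ≠ 0)
    (hZc : ContinuousAt (fun z : (V × ℝ) × V => familyPartition μ T z.1 z.2) (x, l)) :
    ContinuousAt (fun z : (V × ℝ) × V => familyDualDeriv μ T z.1 z.2) (x, l) := by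
  have h2 := hZc.inv₀ hZ
  unfold familyDualDeriv
  exact ContinuousAt.sub (by fun_prop)
    (h2.smul (continuousAt_familyPartitionDeriv hT hT1 hx l))

theorem familyDualDeriv_inl [CompactSpace S] [CompleteSpace V]
    (hT : Continuous T) (x : V × ℝ) (l A : V) :
    familyDualDeriv μ T x l (A, 0) = inner ℝ (l - ∫ p in {p | 0 < affineForm (T p) x},
      ((familyPartition μ T x l)⁻¹ * Real.exp (inner ℝ l (T p))) • T p ∂μ) A := by
  have hi : Integrable (fun p => Real.exp (inner ℝ l (T p)) • T p)
      (μ.restrict {p | 0 < affineForm (T p) x}) :=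
    (integrable_of_continuous (by fun_prop)).integrableOn
  have h1 : familyPartitionDeriv μ T x l (A, 0)
      = inner ℝ A (∫ p in {p | 0 < affineForm (T p) x}, Real.exp (inner ℝ l (T p)) • T p ∂μ) := by
    have hi' : IntegrableOn (fun p => Real.exp (inner ℝ l (T p)) • affineForm (T p))
        {p | 0 < affineForm (T p) x} μ := (integrable_of_continuous (by fun_prop)).integrableOn
    rw [familyPartitionDeriv, ContinuousLinearMap.integral_apply hi', ← integral_inner hi]
    refine integral_congr_ae (Eventually.of_forall fun p => ?_)
    simp [affineForm_apply, real_inner_smul_right]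
  simp only [mul_smul]
  rw [integral_smul, inner_sub_left, real_inner_smul_left, real_inner_comm A (∫ p in _, _ ∂μ), ← h1]
  rfl

theorem familyDualDeriv_inr [CompactSpace S]
    (hT : Continuous T) (x : V × ℝ) (l : V) :
    familyDualDeriv μ T x l (0, 1) = ∫ p in {p | 0 < affineForm (T p) x},
      (familyPartition μ T x l)⁻¹ * Real.exp (inner ℝ l (T p)) ∂μ := by
  have h1 : familyPartitionDeriv μ T x l (0, 1)
      = -∫ p in {p | 0 < affineForm (T p) x}, Real.exp (inner ℝ l (T p)) ∂μ := by
    have hi' : IntegrableOn (fun p => Real.exp (inner ℝ l (T p)) • affineForm (T p))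
        {p | 0 < affineForm (T p) x} μ := (integrable_of_continuous (by fun_prop)).integrableOn
    rw [familyPartitionDeriv, ContinuousLinearMap.integral_apply hi', ← integral_neg]
    refine integral_congr_ae (Eventually.of_forall fun p => ?_)
    simp [affineForm_apply]
  rw [integral_const_mul]
  change inner ℝ l (0 : V) - (familyPartition μ T x l)⁻¹ * familyPartitionDeriv μ T x l (0, 1) = _
  rw [h1, inner_zero_right]
  ring

/-- Regularity and partial derivatives of a function `J` that equals the maximum of the dual
objective function on an open set `N`, given a continuous choice `Λ` of maximisers. -/
theorem regularity_of_eq_familyDual [CompactSpace S] [SecondCountableTopology S] [CompleteSpace V]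
    (hT : Continuous T) (hT1 : ∀ p, ‖T p‖ ≤ 1)
    {N : Set (V × ℝ)} (hN : IsOpen N) (hnull : ∀ x ∈ N, ∀ᵐ p ∂μ, affineForm (T p) x ≠ 0)
    (hZ : ∀ x ∈ N, ∀ l, familyPartition μ T x l ≠ 0)
    (hZc : Continuous fun z : (V × ℝ) × V => familyPartition μ T z.1 z.2)
    {Λ : V × ℝ → V} (hΛc : ∀ x ∈ N, ContinuousAt Λ x)
    (hΛ : ∀ x ∈ N, ∀ l, familyDual μ T x l ≤ familyDual μ T x (Λ x))
    {J : V × ℝ → ℝ} (hJ : ∀ x ∈ N, J x = familyDual μ T x (Λ x)) :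
    ContDiffOn ℝ 1 J N ∧ ∀ x ∈ N,
      HasGradientAt (fun Q => J (Q, x.2)) (Λ x - ∫ p in {p | 0 < affineForm (T p) x},
        ((familyPartition μ T x (Λ x))⁻¹ * Real.exp (inner ℝ (Λ x) (T p))) • T p ∂μ) x.1 ∧
      HasDerivAt (fun η => J (x.1, η)) (∫ p in {p | 0 < affineForm (T p) x},
        (familyPartition μ T x (Λ x))⁻¹ * Real.exp (inner ℝ (Λ x) (T p)) ∂μ) x.2 := by
  have hcont : ∀ x ∈ N, ∀ l,
      ContinuousAt (fun z : (V × ℝ) × V => familyDualDeriv μ T z.1 z.2) (x, l) := fun x hx l =>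
    continuousAt_familyDualDeriv hT hT1 (hnull x hx) (hZ x hx l) hZc.continuousAt
  have hd : ∀ x ∈ N, HasFDerivAt J (familyDualDeriv μ T x (Λ x)) x := by
    intro x hx
    have hev : ∀ᶠ y in 𝓝 x, y ∈ N := hN.mem_nhds hx
    refine HasFDerivAt.congr_of_eventuallyEq (f := fun y => familyDual μ T y (Λ y)) ?_
      (hev.mono hJ)
    refine hasFDerivAt_of_forall_le (G' := familyDualDeriv μ T) ?_ (hcont x hx _) (hΛc x hx)
      (hev.mono hΛ)
    have hev' : ∀ᶠ z : (V × ℝ) × V in 𝓝 (x, Λ x), z.1 ∈ N :=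
      continuous_fst.continuousAt.eventually hev
    exact hev'.mono fun z hz => hasFDerivAt_familyDual hT (hnull _ hz) (hZ _ hz z.2)
  refine ⟨?_, fun x hx => ⟨?_, ?_⟩⟩
  · rw [show (1 : WithTop ℕ∞) = 0 + 1 from (zero_add 1).symm,
      contDiffOn_succ_iff_fderiv_of_isOpen hN]
    refine ⟨fun x hx => (hd x hx).differentiableAt.differentiableWithinAt, by simp, ?_⟩
    rw [contDiffOn_zero]
    have hc : ContinuousOn (fun x => familyDualDeriv μ T x (Λ x)) N := fun x hx =>
      (ContinuousAt.comp (x := x) (f := fun x => (x, Λ x))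
        (g := fun z : (V × ℝ) × V => familyDualDeriv μ T z.1 z.2) (hcont x hx _)
        (continuousAt_id.prodMk (hΛc x hx))).continuousWithinAt
    exact hc.congr fun x hx => (hd x hx).fderiv
  · have h1 : HasFDerivAt (fun Q : V => (Q, x.2)) (ContinuousLinearMap.inl ℝ V ℝ) x.1 :=
      hasFDerivAt_prodMk_left x.1 x.2
    refine ((hd x hx).comp x.1 h1).congr_fderiv ?_
    ext1 A
    rw [InnerProductSpace.toDual_apply_apply]
    exact familyDualDeriv_inl hT x (Λ x) A
  · have h1 : HasDerivAt (fun η : ℝ => (x.1, η)) ((0 : V), (1 : ℝ)) x.2 :=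
      (hasDerivAt_const x.2 x.1).prodMk (hasDerivAt_id x.2)
    have h2 := (hd x hx).comp_hasDerivAt x.2 h1
    rw [familyDualDeriv_inr hT] at h2
    exact h2

end ValueFunction

/-! ### Optimal multipliers and densities -/

/-- The boundary of `E_Q` is a null set. -/
theorem ae_affineForm_ne_zero {x : Sym0 × ℝ} (hx : x ∈ nondegenerate) :
    ∀ᵐ p ∂area, affineForm (pointTensor p) x ≠ 0 := by
  simp only [affineForm_apply, ← quad_eq_inner, sub_ne_zero]
  rcases eq_or_ne x.1 0 with h0 | h0
  · obtain ⟨q, hq⟩ := posSet_nonempty hx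
    have hz : ∀ p, quad x.1 p = 0 := fun p => by rw [h0, quad_eq_inner, inner_zero_left]
    refine Eventually.of_forall fun p => ?_
    have : x.2 < quad x.1 q := hq
    rw [hz] at this ⊢
    exact this.ne'
  · exact ae_quad_ne h0 x.2

theorem familyPartition_eq (x : Sym0 × ℝ) (l : Sym0) :
    familyPartition area pointTensor x l = partitionFn x.1 x.2 l := by
  simp only [familyPartition, partitionFn, affineForm_apply, quad_eq_inner]

theorem familyDual_eq (x : Sym0 × ℝ) (l : Sym0) :
    familyDual area pointTensor x l = dualF x.1 x.2 l := by
  rw [familyDual, familyPartition_eq]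
  rfl

theorem setOf_affineForm_pos (x : Sym0 × ℝ) :
    {p | 0 < affineForm (pointTensor p) x} = posSet x.1 x.2 := by
  ext p
  rw [mem_ofPred_eq, affineForm_apply, sub_pos, ← quad_eq_inner]
  rfl

/-- A choice of maximiser of the dual objective function. -/
noncomputable def multiplier (x : Sym0 × ℝ) : Sym0 := Classical.epsilon (IsDualMaximiser x.1 x.2)

theorem isDualMaximiser_multiplier {x : Sym0 × ℝ} (hx : x ∈ nondegenerate) :
    IsDualMaximiser x.1 x.2 (multiplier x) :=
  Classical.epsilon_spec (exists_isDualMaximiser hx)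

theorem continuousAt_multiplier {x : Sym0 × ℝ} (hx : x ∈ nondegenerate) :
    ContinuousAt multiplier x := by
  have hev : ∀ᶠ y in 𝓝 x, y ∈ nondegenerate := isOpen_nondegenerate.mem_nhds hx
  obtain ⟨δ, hδ, C, h⟩ := exists_dualF_le hx
  have h0 : ∀ᶠ y in 𝓝 x, dualF x.1 x.2 0 - 1 < dualF y.1 y.2 0 := by
    have hc : ContinuousAt (fun y : Sym0 × ℝ => dualF y.1 y.2 0) x :=
      ContinuousAt.comp (x := x) (f := fun y => (y, (0 : Sym0)))
        (g := fun z : (Sym0 × ℝ) × Sym0 => dualF z.1.1 z.1.2 z.2) (continuousAt_dualF hx 0)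
        (by fun_prop)
    exact continuousAt_const.eventually_lt hc (sub_one_lt _)
  refine continuousAt_of_forall_le_of_forall_lt
    (G := fun (y : Sym0 × ℝ) (l : Sym0) => dualF y.1 y.2 l)
    (isCompact_closedBall (0 : Sym0) ((C - (dualF x.1 x.2 0 - 1)) / δ)) (continuousAt_dualF hx)
    ?_ (hev.mono fun y hy => isDualMaximiser_multiplier hy) fun l hl => ?_
  · filter_upwards [hev, h, h0] with y hy h1 h2
    rw [mem_closedBall_zero_iff, le_div_iff₀ hδ]
    have h3 := h1 (multiplier y)
    have h4 := isDualMaximiser_multiplier hy 0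
    linarith
  · refine lt_of_le_of_ne (isDualMaximiser_multiplier hx l) fun heq => hl ?_
    refine IsDualMaximiser.unique hx (fun l' => ?_) (isDualMaximiser_multiplier hx)
    exact (isDualMaximiser_multiplier hx l').trans_eq heq.symm

theorem IsOptimal.div_ae_eq {Q : Sym0} {η : ℝ} (h : (posSet Q η).Nonempty) {L : Sym0}
    (hL : IsDualMaximiser Q η L) {f : S2 → ℝ} (hf : IsOptimal Q η f) :
    (fun p => f p / (quad Q p - η)) =ᵐ[area.restrict (posSet Q η)]
      fun p => (partitionFn Q η L)⁻¹ * Real.exp (quad L p) := by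
  filter_upwards [ae_restrict_of_ae (hf.ae_eq_gibbs h hL),
    ae_restrict_mem (isOpen_posSet Q η).measurableSet] with p h1 h2
  have hw : 0 < quad Q p - η := sub_pos.2 h2
  rw [h1, gibbs_eq_div h, max_eq_left hw.le]
  field_simp

/-- The value function is continuously differentiable, with partial derivatives expressed by the
maximiser; the integrands are `f_Q / (Q p · p - η)` on `E_Q` by `IsOptimal.div_ae_eq`. -/
theorem regularity_auxJ :
    ContDiffOn ℝ 1 (fun x : Sym0 × ℝ => (auxJ x.1 x.2).toReal) nondegenerate ∧
    ∀ x ∈ nondegenerate,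
      HasGradientAt (fun Q => (auxJ Q x.2).toReal) (multiplier x - ∫ p in posSet x.1 x.2,
        ((partitionFn x.1 x.2 (multiplier x))⁻¹ * Real.exp (quad (multiplier x) p))
          • pointTensor p ∂area) x.1 ∧
      HasDerivAt (fun η => (auxJ x.1 η).toReal) (∫ p in posSet x.1 x.2,
        (partitionFn x.1 x.2 (multiplier x))⁻¹ * Real.exp (quad (multiplier x) p) ∂area) x.2 := by
  have h := regularity_of_eq_familyDual (μ := area) (T := pointTensor) (N := nondegenerate)
    (Λ := multiplier) (J := fun x => (auxJ x.1 x.2).toReal) continuous_pointTensor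
    norm_pointTensor_le isOpen_nondegenerate (fun x hx => ae_affineForm_ne_zero hx)
    (fun x hx l => by
      rw [familyPartition_eq]; exact (partitionFn_pos (posSet_nonempty hx) l).ne')
    (by simp only [familyPartition_eq]; exact continuous_partitionFn)
    (fun x hx => continuousAt_multiplier hx)
    (fun x hx l => by
      rw [familyDual_eq, familyDual_eq]; exact isDualMaximiser_multiplier hx l)
    (fun x hx => by
      rw [familyDual_eq, auxJ_eq_dualF (posSet_nonempty hx) (isDualMaximiser_multiplier hx),
        EReal.toReal_coe])
  simp only [familyPartition_eq, setOf_affineForm_pos, ← quad_eq_inner] at h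
  exact h

end Nematic

theorem mainTheorem6 :
    IsOpen Nematic.domJ ∧
    (∀ x ∈ Nematic.domJ, Nematic.auxJ x.1 x.2 ≠ ⊥) ∧
    ContDiffOn ℝ 1 (fun x : Nematic.Sym0 × ℝ => (Nematic.auxJ x.1 x.2).toReal) Nematic.domJ ∧
    ∀ (Q : Nematic.Sym0) (η : ℝ), (Q, η) ∈ Nematic.domJ →
      (∃! L : Nematic.Sym0, Nematic.IsDualMaximiser Q η L) ∧
      (∃ f : Nematic.S2 → ℝ, Nematic.IsOptimal Q η f ∧
        ∀ g : Nematic.S2 → ℝ, Nematic.IsOptimal Q η g → g =ᵐ[Nematic.area] f) ∧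
      ∀ (L : Nematic.Sym0) (f : Nematic.S2 → ℝ),
        Nematic.IsDualMaximiser Q η L → Nematic.IsOptimal Q η f →
          IntegrableOn (fun p => f p / (Nematic.quad Q p - η)) (Nematic.posSet Q η) Nematic.area ∧
          HasGradientAt (fun Q' : Nematic.Sym0 => (Nematic.auxJ Q' η).toReal)
            (L - ∫ p in Nematic.posSet Q η,
              (f p / (Nematic.quad Q p - η)) • Nematic.pointTensor p ∂Nematic.area) Q ∧
          HasDerivAt (fun η' : ℝ => (Nematic.auxJ Q η').toReal)
            (∫ p in Nematic.posSet Q η, f p / (Nematic.quad Q p - η) ∂Nematic.area) η := by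
  rw [Nematic.domJ_eq_nondegenerate]
  refine ⟨Nematic.isOpen_nondegenerate, fun x hx => ?_, Nematic.regularity_auxJ.1,
    fun Q η hx => ?_⟩
  · obtain ⟨L, hL⟩ := Nematic.exists_isDualMaximiser hx
    rw [Nematic.auxJ_eq_dualF (Nematic.posSet_nonempty hx) hL]
    exact EReal.coe_ne_bot _
  obtain ⟨L₀, hL₀⟩ := Nematic.exists_isDualMaximiser hx
  have h : (Nematic.posSet Q η).Nonempty := Nematic.posSet_nonempty hx
  refine ⟨⟨L₀, hL₀, fun L hL => Nematic.IsDualMaximiser.unique hx hL hL₀⟩,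
    ⟨_, Nematic.isOptimal_gibbs h hL₀, fun g hg => hg.ae_eq_gibbs h hL₀⟩, fun L f hL hf => ?_⟩
  have hmul : Nematic.multiplier (Q, η) = L :=
    Nematic.IsDualMaximiser.unique hx (Nematic.isDualMaximiser_multiplier hx) hL
  have hdiv := hf.div_ae_eq h hL
  obtain ⟨hgrad, hder⟩ := Nematic.regularity_auxJ.2 (Q, η) hx
  rw [hmul] at hgrad hder
  refine ⟨?_, ?_, ?_⟩
  · refine Integrable.congr ?_ hdiv.symm
    exact (Nematic.integrable_of_continuous (by fun_prop)).integrableOn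
  · have he : ∫ p in Nematic.posSet Q η,
        (f p / (Nematic.quad Q p - η)) • Nematic.pointTensor p ∂Nematic.area
        = ∫ p in Nematic.posSet Q η, ((Nematic.partitionFn Q η L)⁻¹
          * Real.exp (Nematic.quad L p)) • Nematic.pointTensor p ∂Nematic.area :=
      integral_congr_ae (hdiv.mono fun p hp => by simp only [hp])
    rw [he]
    exact hgrad
  · rw [integral_congr_ae hdiv]
    exact hder
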